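/- Let $H$ be a complex Hilbert space of finite dimension $d\ge 4$. An ontological model for $H$ consists of a measurable space $\Lambda$ of ontic states; for every pure state (unit vector) $\psi\in H$, a probability measure $\mu_\psi$ on $\Lambda$; and, for every measurement $M$ in an orthonormal basis of $H$ and every outcome $f$ (a vector of that basis), a measurable response function $\xi_M(f\mid\cdot):\Lambda\to[0,\infty)$ such that $\sum_{f}\xi_M(f\mid\lambda)=1$ for every $\lambda\in\Lambda$. The model reproduces the quantum predictions if $$\int_\Lambda \xi_M(f\mid\lambda)\,d\mu_\psi(\lambda)=|\langle f|\psi\rangle|^2\qquad\text{for all } \psi, M \text{ and outcomes } f \text{ of } M.$$ For probability measures $\mu,\nu$ on $\Lambda$ with densities $p,q$ with respect to a common reference measure, written $dx$ (such as $\mu+\nu$), let $\omega_C(\mu,\nu)=1-\tfrac12\int|p(x)-q(x)|\,dx$ be the classical overlap. For pure states let $\omega_Q(\psi,\phi)=1-\sqrt{1-|\langle\psi|\phi\rangle|^2}$ be the quantum overlap. Theorem. Suppose that an ontological model for $H$ reproduces the quantum predictions and that, for some real constant $k$, $$\omega_C(\mu_\psi,\mu_\phi)\ \ge\ k\,\omega_Q(\psi,\phi)\qquad\text{for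 all pure states }\psi,\phi .$$ Then $k<\dfrac{4}{d-1}$. If moreover $d$ is a prime power, then $k<\dfrac{2}{d}$. -/

import Mathlib

open MeasureTheory Module

noncomputable section

/-- The trace distance `½ ∫ |p(x) - q(x)| dx` of two probability distributions. The densities are
taken with respect to `p + q`, which dominates both; the value does not depend on the choice of the
reference measure, see `classicalTraceDistance_withDensity`. -/
def classicalTraceDistance {Λ : Type*} [MeasurableSpace Λ] (p q : Measure Λ) : ℝ :=
  (1 / 2) * ∫ x, |(p.rnDeriv (p + q) x).toReal - (q.rnDeriv (p + q) x).toReal| ∂(p + q)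

/-- The classical overlap `ω_C(p, q) = 1 - δ_C(p, q)`. -/
def classicalOverlap {Λ : Type*} [MeasurableSpace Λ] (p q : Measure Λ) : ℝ :=
  1 - classicalTraceDistance p q

/-- If `p` and `q` have densities `f` and `g` with respect to any measure `m` (σ-finite or not), then
`δ_C(p, q) = ½ ∫ |f - g| dm`. -/
theorem classicalTraceDistance_withDensity {Λ : Type*} [MeasurableSpace Λ] (m : Measure Λ)
    (f g : Λ → ℝ) (hf : Measurable f) (hg : Measurable g) (hf0 : ∀ x, 0 ≤ f x)
    (hg0 : ∀ x, 0 ≤ g x) (hfi : Integrable f m) (hgi : Integrable g m) :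
    classicalTraceDistance (m.withDensity fun x => ENNReal.ofReal (f x))
      (m.withDensity fun x => ENNReal.ofReal (g x)) = (1 / 2) * ∫ x, |f x - g x| ∂m := by
  set p := m.withDensity fun x => ENNReal.ofReal (f x) with hp
  set q := m.withDensity fun x => ENNReal.ofReal (g x) with hq
  have hfl : ∫⁻ x, ENNReal.ofReal (f x) ∂m ≠ ⊤ := hfi.lintegral_lt_top.ne
  have hgl : ∫⁻ x, ENNReal.ofReal (g x) ∂m ≠ ⊤ := hgi.lintegral_lt_top.ne
  have : IsFiniteMeasure p := isFiniteMeasure_withDensity hfl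
  have : IsFiniteMeasure q := isFiniteMeasure_withDensity hgl
  have hs : p + q = m.withDensity fun x => ENNReal.ofReal (f x + g x) := by
    rw [hp, hq, ← withDensity_add_left hf.ennreal_ofReal]
    congr 1
    funext x
    exact (ENNReal.ofReal_add (hf0 x) (hg0 x)).symm
  have hm : Measurable fun x => ENNReal.ofReal (f x + g x) := (hf.add hg).ennreal_ofReal
  have key : ∀ (r : Measure Λ) [IsFiniteMeasure r] (h : Λ → ℝ), Measurable h → (∀ x, 0 ≤ h x) →
      ∫⁻ x, ENNReal.ofReal (h x) ∂m ≠ ⊤ → r = m.withDensity (fun x => ENNReal.ofReal (h x)) →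
      r ≤ p + q → ∀ᵐ x ∂m, (f x + g x) * (r.rnDeriv (p + q) x).toReal = h x := by
    intro r _ h hh hh0 hhl hr hle
    have h1 : (p + q).withDensity (r.rnDeriv (p + q)) = r :=
      Measure.withDensity_rnDeriv_eq _ _ (Measure.absolutelyContinuous_of_le hle)
    have hmr : Measurable (r.rnDeriv (p + q)) := Measure.measurable_rnDeriv _ _
    have h2 : m.withDensity (fun x => ENNReal.ofReal (h x)) =
        m.withDensity ((fun x => ENNReal.ofReal (f x + g x)) * r.rnDeriv (p + q)) := by
      rw [withDensity_mul _ hm hmr, ← hs, h1, hr]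
    have h3 := (withDensity_eq_iff hh.ennreal_ofReal.aemeasurable
      (hm.mul hmr).aemeasurable hhl).1 h2
    filter_upwards [h3] with x hx
    have := congrArg ENNReal.toReal hx
    simp only [Pi.mul_apply, ENNReal.toReal_mul] at this
    rw [ENNReal.toReal_ofReal (hh0 x), ENNReal.toReal_ofReal (add_nonneg (hf0 x) (hg0 x))] at this
    exact this.symm
  have kp := key p f hf hf0 hfl hp (Measure.le_add_right le_rfl)
  have kq := key q g hg hg0 hgl hq (Measure.le_add_left le_rfl)
  have hi : ∀ F : Λ → ℝ, ∫ x, F x ∂(p + q) = ∫ x, (f x + g x) * F x ∂m := by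
    intro F
    rw [hs, integral_withDensity_eq_integral_toReal_smul hm (by simp)]
    refine integral_congr_ae (Filter.Eventually.of_forall fun x => ?_)
    simp only [smul_eq_mul]
    rw [ENNReal.toReal_ofReal (add_nonneg (hf0 x) (hg0 x))]
  rw [classicalTraceDistance, hi]
  congr 1
  refine integral_congr_ae ?_
  filter_upwards [kp, kq] with x hx hy
  nth_rewrite 1 [← abs_of_nonneg (add_nonneg (hf0 x) (hg0 x))]
  rw [← abs_mul, mul_sub, hx, hy]

section Quantum

variable (H : Type*) [NormedAddCommGroup H] [InnerProductSpace ℂ H]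

/-- Pure quantum states, as unit vectors. -/
def QState : Type _ := {ψ : H // ‖ψ‖ = 1}

/-- Measurements in an orthonormal basis; the outcomes are the vectors of the basis. -/
abbrev QMeasurement : Type _ := OrthonormalBasis (Fin (finrank ℂ H)) ℂ H

variable {H}

/-- The trace distance `√(1 - |⟨ψ|φ⟩|²)` of two pure states. -/
def quantumTraceDistance (ψ φ : QState H) : ℝ :=
  √(1 - ‖inner ℂ ψ.1 φ.1‖ ^ 2)

/-- The quantum overlap `ω_Q(ψ, φ) = 1 - δ_Q(ψ, φ)`. -/
def quantumOverlap (ψ φ : QState H) : ℝ :=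
  1 - quantumTraceDistance ψ φ

variable (H)

/-- An ontological model with ontic state space `Λ`. Response functions may depend on the whole
basis that is measured, and epistemic states on the phase of the unit vector. -/
structure OntologicalModel (Λ : Type*) [MeasurableSpace Λ] where
  /-- The epistemic state `μ_ψ`. -/
  epistemic : QState H → Measure Λ
  isProbabilityMeasure_epistemic : ∀ ψ, IsProbabilityMeasure (epistemic ψ)
  /-- The response function `ξ_M(f | l)` of the outcome `f = M i`. -/
  response : QMeasurement H → Fin (finrank ℂ H) → Λ → ℝ
  measurable_response : ∀ M i, Measurable (response M i)
  response_nonneg : ∀ M i l, 0 ≤ response M i l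
  sum_response : ∀ M l, ∑ i, response M i l = 1

variable {H}

/-- The model yields the probability `|⟨f|ψ⟩|²` for every pure state, every measurement and every
outcome. -/
def OntologicalModel.ReproducesQuantumPredictions {Λ : Type*} [MeasurableSpace Λ]
    (m : OntologicalModel H Λ) : Prop :=
  ∀ (ψ : QState H) (M : QMeasurement H) (i : Fin (finrank ℂ H)),
    ∫ l, m.response M i l ∂(m.epistemic ψ) = ‖inner ℂ (M i) ψ.1‖ ^ 2

end Quantum

end

-- If a measurement has no outcome possible for all of `ψ`, `φ`, `χ`, then their epistemic densities
-- are almost nowhere simultaneously positive: there every response would vanish, yet responses sum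
-- to one. So if `ψ` and any two members of a family `φ t` are excluded in this way, the overlaps of
-- `μ_ψ` with the `μ_{φ t}` occupy essentially disjoint regions and sum to at most 1
-- (`sum_classicalOverlap_le_one`).
--
-- It remains to find a large family (`exists_conclusivelyExcluded_family`). Take `ψ` in an
-- orthonormal basis and `φ t` with coordinates of modulus `1/√d`. Two phase vectors, both with
-- phase 1 along `ψ`, are excluded with `ψ` once their phase ratios at two coordinates are opposite
-- (`conclusivelyExcluded_phaseVector`). Sixteen phase words on four coordinates, with free signs on
-- the others, give `2^d ≥ d²` vectors. Hence `d² k (1 - √(1 - 1/d)) ≤ 1` for `k > 0`, and `1 - √(1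
-- - 1/d) > 1/(2d)` yields `k < 2/d < 4/(d-1)`.

open scoped ComplexConjugate

-- Criteria for conclusive exclusion.

section ConclusiveExclusion

variable {H : Type*} [NormedAddCommGroup H] [InnerProductSpace ℂ H]

/-- Some measurement has no outcome that is possible for all three vectors. -/
def ConclusivelyExcluded (ψ φ χ : H) : Prop :=
  ∃ M : QMeasurement H, ∀ i,
    inner ℂ (M i) ψ = 0 ∨ inner ℂ (M i) φ = 0 ∨ inner ℂ (M i) χ = 0

/-- Complete `f, g` to an orthonormal basis: `f` rules out `φ`, `g` rules out `χ`, and all other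
outcomes are orthogonal to the plane containing `ψ`. -/
theorem conclusivelyExcluded_of_mem_span [FiniteDimensional ℂ H] {ψ φ χ f g : H}
    (hf : ‖f‖ = 1) (hg : ‖g‖ = 1) (hfg : inner ℂ f g = 0) (hfφ : inner ℂ f φ = 0)
    (hgχ : inner ℂ g χ = 0) (hψ : ψ ∈ Submodule.span ℂ {f, g}) :
    ConclusivelyExcluded ψ φ χ := by
  have hli : Orthonormal ℂ ![f, g] := by
    rw [orthonormal_vecCons_iff]
    refine ⟨hf, fun i => ?_, ?_⟩
    · fin_cases i
      simpa using hfg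
    · rw [orthonormal_vecCons_iff]
      exact ⟨hg, fun i => i.elim0, ⟨fun i => i.elim0, fun i => i.elim0⟩⟩
  have hcard : 2 ≤ finrank ℂ H := by
    simpa using hli.linearIndependent.fintype_card_le_finrank
  let i₀ : Fin (finrank ℂ H) := ⟨0, by omega⟩
  let i₁ : Fin (finrank ℂ H) := ⟨1, by omega⟩
  have h10 : i₁ ≠ i₀ := by simp [i₀, i₁]
  let v : Fin (finrank ℂ H) → H := fun i => if i = i₀ then f else g
  have hv : Orthonormal ℂ (({i₀, i₁} : Set (Fin (finrank ℂ H))).domRestrict v) := by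
    constructor
    · rintro ⟨i, rfl | rfl⟩
      · simpa [v, Set.domRestrict] using hf
      · simpa [v, h10, Set.domRestrict] using hg
    · rintro ⟨i, rfl | rfl⟩ ⟨j, rfl | rfl⟩ hij
      · exact absurd rfl hij
      · simpa [v, h10, Set.domRestrict] using hfg
      · simpa [v, h10, Set.domRestrict] using inner_eq_zero_symm.1 hfg
      · exact absurd rfl hij
  obtain ⟨b, hb⟩ := hv.exists_orthonormalBasis_extension_of_card_eq (by simp)
  have hb0 : b i₀ = f := by rw [hb i₀ (by simp)]; simp [v]
  have hb1 : b i₁ = g := by rw [hb i₁ (by simp)]; simp [v, h10]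
  refine ⟨b, fun i => ?_⟩
  by_cases h0 : i = i₀
  · exact Or.inr (Or.inl (by rw [h0, hb0, hfφ]))
  by_cases h1 : i = i₁
  · exact Or.inr (Or.inr (by rw [h1, hb1, hgχ]))
  left
  obtain ⟨s, t, rfl⟩ := Submodule.mem_span_pair.1 hψ
  have e0 : inner ℂ (b i) f = 0 := by rw [← hb0]; exact b.orthonormal.2 h0
  have e1 : inner ℂ (b i) g = 0 := by rw [← hb1]; exact b.orthonormal.2 h1
  simp [e0, e1]

/-- The vectors `(ψ ± w)/√2` are orthonormal with `ψ` in their span; the sign conditions make the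
first orthogonal to `φ` and the second to `χ`. -/
theorem conclusivelyExcluded_of_reflected [FiniteDimensional ℂ H] {ψ φ χ w : H}
    (hψ : ‖ψ‖ = 1) (hw : inner ℂ w w = (1 : ℂ)) (hψw : inner ℂ ψ w = 0)
    (hφ : inner ℂ w φ = -inner ℂ ψ φ) (hχ : inner ℂ w χ = inner ℂ ψ χ) :
    ConclusivelyExcluded ψ φ χ := by
  have hψψ : inner ℂ ψ ψ = (1 : ℂ) := by simp [inner_self_eq_norm_sq_to_K, hψ]
  have hwψ : inner ℂ w ψ = 0 := inner_eq_zero_symm.1 hψw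
  have h2 : ((√2 : ℝ) : ℂ) * ((√2 : ℝ) : ℂ) = 2 := by
    rw [← Complex.ofReal_mul, Real.mul_self_sqrt (by norm_num)]; norm_num
  have hnorm : ∀ x : H, inner ℂ x x = (2 : ℂ) → ‖(((√2 : ℝ) : ℂ))⁻¹ • x‖ = 1 := by
    intro x hx
    have hx2 : ‖x‖ ^ 2 = 2 := by
      rw [inner_self_eq_norm_sq_to_K, ← RCLike.ofReal_pow] at hx
      exact Complex.ofReal_injective (by simpa using hx)
    have hxs : ‖x‖ = √2 := by rw [← hx2, Real.sqrt_sq (norm_nonneg _)]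
    rw [norm_smul, hxs, norm_inv, Complex.norm_real, Real.norm_of_nonneg (Real.sqrt_nonneg _)]
    exact inv_mul_cancel₀ (by positivity)
  refine conclusivelyExcluded_of_mem_span (f := (((√2 : ℝ) : ℂ))⁻¹ • (ψ + w))
    (g := (((√2 : ℝ) : ℂ))⁻¹ • (ψ - w)) (hnorm _ ?_) (hnorm _ ?_) ?_ ?_ ?_ ?_
  · simp only [inner_add_left, inner_add_right, hψψ, hw, hψw, hwψ]; norm_num
  · simp only [inner_sub_left, inner_sub_right, hψψ, hw, hψw, hwψ]; norm_num
  · simp only [inner_smul_left, inner_smul_right, inner_add_left, inner_sub_right, hψψ, hw, hψw,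
      hwψ]
    norm_num
  · simp only [inner_smul_left, inner_add_left, hφ]; simp
  · simp only [inner_smul_left, inner_sub_left, hχ]; simp
  · refine Submodule.mem_span_pair.2 ⟨(((√2 : ℝ) : ℂ))⁻¹, (((√2 : ℝ) : ℂ))⁻¹, ?_⟩
    have : ψ + w + (ψ - w) = (2 : ℂ) • ψ := by rw [two_smul]; abel
    rw [← smul_add, ← smul_add, this, smul_smul, smul_smul, ← mul_inv, h2]
    norm_num

end ConclusiveExclusion

-- Exclusion for vectors with coordinates of equal modulus.

section PhaseVectors

variable {H : Type*} [NormedAddCommGroup H] [InnerProductSpace ℂ H] {ι : Type*} [Fintype ι]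

/-- The combination of the vectors of an orthonormal basis whose coefficients are given phases,
scaled by `1 / √(card ι)`. -/
noncomputable def phaseVector (e : OrthonormalBasis ι ℂ H) (a : ι → ℂ) : H :=
  ∑ i, (a i * ((√(Fintype.card ι) : ℝ) : ℂ)⁻¹) • e i

theorem inner_phaseVector (e : OrthonormalBasis ι ℂ H) (a : ι → ℂ) (i : ι) :
    inner ℂ (e i) (phaseVector e a) = a i * ((√(Fintype.card ι) : ℝ) : ℂ)⁻¹ :=
  e.orthonormal.inner_right_fintype _ i

theorem norm_phaseVector [Nonempty ι] (e : OrthonormalBasis ι ℂ H) {a : ι → ℂ}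
    (ha : ∀ i, ‖a i‖ = 1) : ‖phaseVector e a‖ = 1 := by
  have hs : (0 : ℝ) < Fintype.card ι := by exact_mod_cast Fintype.card_pos
  have h : ‖phaseVector e a‖ ^ 2 = 1 := by
    rw [← e.sum_sq_norm_inner_right]
    simp only [inner_phaseVector, norm_mul, ha, one_mul, norm_inv, Complex.norm_real,
      Real.norm_of_nonneg (Real.sqrt_nonneg _), inv_pow, Real.sq_sqrt hs.le]
    simp [hs.ne']
  exact (pow_eq_one_iff_of_nonneg (norm_nonneg _) two_ne_zero).1 h

theorem conclusivelyExcluded_phaseVector (e : OrthonormalBasis ι ℂ H) {a b : ι → ℂ}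
    (ha : ∀ i, ‖a i‖ = 1) (hb : ∀ i, ‖b i‖ = 1) {o i j : ι} (hao : a o = 1) (hbo : b o = 1)
    (hij : b i * a j = -(b j * a i)) :
    ConclusivelyExcluded (e o) (phaseVector e a) (phaseVector e b) := by
  classical
  have : FiniteDimensional ℂ H := e.toBasis.finiteDimensional_of_finite
  have hca : ∀ l, conj (a l) * a l = 1 := fun l => by
    rw [Complex.conj_mul', ha]; norm_num
  have hcb : ∀ l, conj (b l) * b l = 1 := fun l => by
    rw [Complex.conj_mul', hb]; norm_num
  have ha0 : ∀ l, a l ≠ 0 := fun l h => by simpa [h] using hca l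
  have hb0 : ∀ l, b l ≠ 0 := fun l h => by simpa [h] using hcb l
  have hne : i ≠ j := by
    rintro rfl
    have : b i * a i = 0 := by linear_combination hij / 2
    exact mul_ne_zero (hb0 i) (ha0 i) this
  have hee : ∀ l l', inner ℂ (e l) (e l') = if l = l' then (1 : ℂ) else 0 :=
    fun l l' => orthonormal_iff_ite.1 e.orthonormal l l'
  -- the opposite pair contains the distinguished index
  have key : ∀ l, l ≠ o → b l = -a l →
      ConclusivelyExcluded (e o) (phaseVector e a) (phaseVector e b) := by
    intro l hl h
    refine conclusivelyExcluded_of_reflected (w := b l • e l) (e.orthonormal.1 o) ?_ ?_ ?_ ?_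
    · simp only [inner_smul_left, inner_smul_right, hee, if_true]
      linear_combination hcb l
    · simp only [inner_smul_right, hee, if_neg hl.symm, mul_zero]
    · simp only [inner_smul_left, inner_phaseVector, hao, h, map_neg]
      linear_combination -((√(Fintype.card ι) : ℝ) : ℂ)⁻¹ * hca l
    · simp only [inner_smul_left, inner_phaseVector, hbo]
      linear_combination ((√(Fintype.card ι) : ℝ) : ℂ)⁻¹ * hcb l
  by_cases hi : i = o
  · subst hi
    refine key j hne.symm ?_
    rw [hao, hbo] at hij
    linear_combination hij
  by_cases hj : j = o
  · subst hj
    refine key i hne ?_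
    rw [hao, hbo] at hij
    linear_combination hij
  have hab : conj (a i) * b i = -(conj (a j) * b j) := by
    linear_combination conj (a i) * conj (a j) * hij - conj (a i) * b i * hca j
      - conj (a j) * b j * hca i
  have hba : conj (b i) * a i = -(conj (b j) * a j) := by
    have := congrArg conj hab
    simp only [map_neg, map_mul, Complex.conj_conj] at this
    linear_combination this
  -- Half the difference of the two vectors on `i, j`, rescaled by `√(card ι)`. It is orthogonal to
  -- `e o` only because `i, j ≠ o`; opposite ratios `conj a * b` cancel the cross terms.
  refine conclusivelyExcluded_of_reflected
    (w := ((b i - a i) / 2) • e i + ((b j - a j) / 2) • e j) (e.orthonormal.1 o) ?_ ?_ ?_ ?_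
  · simp only [inner_add_left, inner_add_right, inner_smul_left, inner_smul_right, hee, if_true,
      if_neg hne, if_neg hne.symm, map_div₀, map_sub, map_ofNat]
    linear_combination (hca i + hca j + hcb i + hcb j - hab - hba) / 4
  · simp only [inner_add_right, inner_smul_right, hee, if_neg (Ne.symm hi), if_neg (Ne.symm hj)]
    ring
  · simp only [inner_add_left, inner_smul_left, inner_phaseVector, map_div₀, map_sub, map_ofNat,
      hao]
    linear_combination ((√(Fintype.card ι) : ℝ) : ℂ)⁻¹ * (hba - hca i - hca j) / 2
  · simp only [inner_add_left, inner_smul_left, inner_phaseVector, map_div₀, map_sub, map_ofNat,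
      hbo]
    linear_combination ((√(Fintype.card ι) : ℝ) : ℂ)⁻¹ * (hcb i + hcb j - hab) / 2

end PhaseVectors

-- The phase words and the resulting family.

section Code

/-- The exponents of `i` in the sixteen vectors of `ℂ⁴` that form, with the standard basis, five
mutually unbiased bases. -/
def kerdockWord (t : Fin 4 × Fin 2 × Fin 2) : Fin 4 → ℕ :=
  let p := (![0, 1, 0, 1] : Fin 4 → ℕ) t.1 + 2 * t.2.1
  let q := (![0, 1, 1, 0] : Fin 4 → ℕ) t.1 + 2 * t.2.2
  ![0, p, q, p + q + 2 * (![0, 0, 1, 1] : Fin 4 → ℕ) t.1]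

/-- Orthogonality or unbiasedness makes the sum of the four phase ratios have modulus 0 or 2. Four
powers of `I` with no opposite pair take at most two adjacent values, so their sum has squared
modulus at least 8. -/
theorem exists_opposite_kerdockWord : ∀ t u, t ≠ u → ∃ i j,
    (kerdockWord u i + kerdockWord t j) % 4 = (kerdockWord u j + kerdockWord t i + 2) % 4 := by
  decide +kernel

/-- Kerdock words on four coordinates, followed by arbitrary signs on `n` coordinates. -/
def extendedWord {n : ℕ} (t : (Fin 4 × Fin 2 × Fin 2) × (Fin n → Fin 2)) : Fin 4 ⊕ Fin n → ℕ :=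
  Sum.elim (kerdockWord t.1) fun l => 2 * t.2 l

theorem extendedWord_inl_zero {n : ℕ} (t : (Fin 4 × Fin 2 × Fin 2) × (Fin n → Fin 2)) :
    extendedWord t (Sum.inl 0) = 0 := rfl

theorem exists_opposite_extendedWord {n : ℕ} {t u : (Fin 4 × Fin 2 × Fin 2) × (Fin n → Fin 2)}
    (h : t ≠ u) : ∃ i j,
    (extendedWord u i + extendedWord t j) % 4 = (extendedWord u j + extendedWord t i + 2) % 4 := by
  by_cases h1 : t.1 = u.1
  · have h2 : t.2 ≠ u.2 := fun h2 => h (Prod.ext h1 h2)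
    obtain ⟨l, hl⟩ := Function.ne_iff.1 h2
    -- Both phases are 1 at the first coordinate, while the signs at `l` are opposite.
    refine ⟨Sum.inl 0, Sum.inr l, ?_⟩
    have hl' : (t.2 l : ℕ) ≠ u.2 l := fun h => hl (Fin.ext h)
    simp only [extendedWord_inl_zero]
    simp only [extendedWord, Sum.elim_inr]
    have := (t.2 l).isLt
    have := (u.2 l).isLt
    omega
  · obtain ⟨i, j, hij⟩ := exists_opposite_kerdockWord t.1 u.1 h1
    exact ⟨Sum.inl i, Sum.inl j, hij⟩

theorem I_pow_eq_neg_of_mod {m n : ℕ} (h : m % 4 = (n + 2) % 4) :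
    Complex.I ^ m = -Complex.I ^ n := by
  rw [Complex.I_pow_eq_pow_mod, h, ← Complex.I_pow_eq_pow_mod, pow_add, Complex.I_sq]
  ring

theorem sq_add_four_le_two_pow (n : ℕ) : (n + 4) ^ 2 ≤ 2 ^ (n + 4) := by
  induction n with
  | zero => norm_num
  | succ n ih =>
    calc (n + 1 + 4) ^ 2 ≤ (n + 4) ^ 2 * 2 := Nat.le.intro
          (show (n + 1 + 4) ^ 2 + (n ^ 2 + 6 * n + 7) = (n + 4) ^ 2 * 2 by ring)
      _ ≤ 2 ^ (n + 4) * 2 := Nat.mul_le_mul_right 2 ih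
      _ = 2 ^ (n + 1 + 4) := by ring

/-- In dimension `d ≥ 4` there are `d²` vectors, each of overlap `1 / d` with a fixed one, such that
any two of them and the fixed one are conclusively excluded. -/
theorem exists_conclusivelyExcluded_family {H : Type*} [NormedAddCommGroup H]
    [InnerProductSpace ℂ H] {d : ℕ} (hd : 4 ≤ d) (hH : finrank ℂ H = d) :
    ∃ (T : Type) (_ : Fintype T) (ψ : QState H) (φ : T → QState H), d ^ 2 ≤ Fintype.card T ∧
      (∀ t, ‖inner ℂ ψ.1 (φ t).1‖ ^ 2 = 1 / (d : ℝ)) ∧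
      ∀ t u, t ≠ u → ConclusivelyExcluded ψ.1 (φ t).1 (φ u).1 := by
  obtain ⟨n, rfl⟩ : ∃ n, d = n + 4 := ⟨d - 4, by omega⟩
  have : FiniteDimensional ℂ H := FiniteDimensional.of_finrank_pos (by omega)
  have hcard : Fintype.card (Fin 4 ⊕ Fin n) = n + 4 := by simp [add_comm]
  let e : OrthonormalBasis (Fin 4 ⊕ Fin n) ℂ H := (stdOrthonormalBasis ℂ H).reindex
    (Fintype.equivOfCardEq (by rw [hcard, Fintype.card_fin, hH]))
  let a : (Fin 4 × Fin 2 × Fin 2) × (Fin n → Fin 2) → Fin 4 ⊕ Fin n → ℂ :=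
    fun t i => Complex.I ^ extendedWord t i
  have ha : ∀ t i, ‖a t i‖ = 1 := fun t i => by simp [a]
  have ha1 : ∀ t, a t (Sum.inl 0) = 1 := fun t => by simp [a, extendedWord_inl_zero]
  refine ⟨_, inferInstance, ⟨e (Sum.inl 0), e.orthonormal.1 _⟩,
    fun t => ⟨phaseVector e (a t), norm_phaseVector e (ha t)⟩, ?_, fun t => ?_, fun t u htu => ?_⟩
  · refine (sq_add_four_le_two_pow n).trans (le_of_eq ?_)
    simp [pow_add, mul_comm]
  · simp only [inner_phaseVector, ha1, hcard, one_mul, norm_inv, Complex.norm_real,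
      Real.norm_of_nonneg (Real.sqrt_nonneg _), inv_pow]
    rw [Real.sq_sqrt (by positivity), one_div]
  · obtain ⟨i, j, hij⟩ := exists_opposite_extendedWord htu
    refine conclusivelyExcluded_phaseVector e (ha t) (ha u) (ha1 t) (ha1 u) (i := i) (j := j) ?_
    simp only [a, ← pow_add]
    exact I_pow_eq_neg_of_mod hij

end Code

-- Classical overlaps over a common reference measure.

section Overlap

variable {Λ : Type*} [MeasurableSpace Λ]

/-- From `min u v = (u + v - |u - v|)/2`. A single `ν` can serve all pairs, so that overlaps can be
added under one integral. -/
theorem classicalOverlap_eq_integral_min {p q ν : Measure Λ} [IsProbabilityMeasure p]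
    [IsProbabilityMeasure q] [IsFiniteMeasure ν] (hp : p ≪ ν) (hq : q ≪ ν) :
    classicalOverlap p q = ∫ x, min (p.rnDeriv ν x).toReal (q.rnDeriv ν x).toReal ∂ν := by
  have hd : ∀ (r : Measure Λ) [IsProbabilityMeasure r], r ≪ ν →
      r = ν.withDensity fun x => ENNReal.ofReal (r.rnDeriv ν x).toReal := by
    intro r _ hr
    nth_rewrite 1 [← Measure.withDensity_rnDeriv_eq r ν hr]
    refine withDensity_congr_ae ?_
    filter_upwards [r.rnDeriv_lt_top ν] with x hx
    rw [ENNReal.ofReal_toReal hx.ne]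
  have hi : ∀ (r : Measure Λ) [IsProbabilityMeasure r],
      Integrable (fun x => (r.rnDeriv ν x).toReal) ν := fun r _ => Measure.integrable_toReal_rnDeriv
  have h1 : ∀ (r : Measure Λ) [IsProbabilityMeasure r], r ≪ ν →
      ∫ x, (r.rnDeriv ν x).toReal ∂ν = 1 := by
    intro r _ hr
    rw [Measure.integral_toReal_rnDeriv hr]
    simp
  have htd : classicalTraceDistance p q =
      (1 / 2) * ∫ x, |(p.rnDeriv ν x).toReal - (q.rnDeriv ν x).toReal| ∂ν := by
    have := classicalTraceDistance_withDensity ν (fun x => (p.rnDeriv ν x).toReal)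
      (fun x => (q.rnDeriv ν x).toReal) (Measure.measurable_rnDeriv _ _).ennreal_toReal
      (Measure.measurable_rnDeriv _ _).ennreal_toReal (fun _ => ENNReal.toReal_nonneg)
      (fun _ => ENNReal.toReal_nonneg) (hi p) (hi q)
    rwa [← hd p hp, ← hd q hq] at this
  have hmin : ∀ u v : ℝ, min u v = (1 / 2) * (u + v - |u - v|) := fun u v => by
    linarith [min_add_max u v, max_sub_min_eq_abs' u v]
  simp only [hmin]
  have hsub := integral_sub ((hi p).add (hi q)) ((hi p).sub (hi q)).abs
  simp only [Pi.add_apply, Pi.sub_apply] at hsub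
  rw [classicalOverlap, htd, integral_const_mul, hsub, integral_add (hi p) (hi q), h1 p hp, h1 q hq]
  ring

/-- If no three of the densities `p, q t, q u` overlap, then the overlaps of `p` with the `q t` sum
to at most `1`. -/
theorem sum_classicalOverlap_le_one {T : Type*} [Fintype T] {p ν : Measure Λ} {q : T → Measure Λ}
    [IsProbabilityMeasure p] [∀ t, IsProbabilityMeasure (q t)] [IsFiniteMeasure ν]
    (hp : p ≪ ν) (hq : ∀ t, q t ≪ ν)
    (h : ∀ t u, t ≠ u → ∀ᵐ x ∂ν, p.rnDeriv ν x = 0 ∨ (q t).rnDeriv ν x = 0 ∨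
      (q u).rnDeriv ν x = 0) :
    ∑ t, classicalOverlap p (q t) ≤ 1 := by
  classical
  have hi : ∀ t, Integrable
      (fun x => min (p.rnDeriv ν x).toReal ((q t).rnDeriv ν x).toReal) ν :=
    fun t => Measure.integrable_toReal_rnDeriv.inf Measure.integrable_toReal_rnDeriv
  have hae : ∀ᵐ x ∂ν, ∀ t u, t ≠ u → p.rnDeriv ν x = 0 ∨ (q t).rnDeriv ν x = 0 ∨
      (q u).rnDeriv ν x = 0 := by
    rw [ae_all_iff]; intro t
    rw [ae_all_iff]; intro u
    by_cases htu : t = u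
    · exact Filter.Eventually.of_forall fun x h => absurd htu h
    · filter_upwards [h t u htu] with x hx _ using hx
  calc ∑ t, classicalOverlap p (q t)
      = ∫ x, ∑ t, min (p.rnDeriv ν x).toReal ((q t).rnDeriv ν x).toReal ∂ν := by
        rw [integral_finsetSum _ fun t _ => hi t]
        exact Finset.sum_congr rfl fun t _ => classicalOverlap_eq_integral_min hp (hq t)
    _ ≤ ∫ x, (p.rnDeriv ν x).toReal ∂ν := by
        refine integral_mono_ae (integrable_finsetSum _ fun t _ => hi t)
          Measure.integrable_toReal_rnDeriv ?_
        filter_upwards [hae] with x hx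
        -- At almost every point at most one summand is nonzero, and it is bounded by the density of
        -- `p`.
        by_cases hex : ∃ t, min (p.rnDeriv ν x).toReal ((q t).rnDeriv ν x).toReal ≠ 0
        · obtain ⟨t, ht⟩ := hex
          rw [Finset.sum_eq_single t]
          · exact min_le_left _ _
          · intro u _ hut
            rcases hx t u hut.symm with h0 | h0 | h0
            · simp [h0]
            · simp [h0] at ht
            · simp [h0]
          · simp
        · push Not at hex
          simp [hex]
    _ = 1 := by
        rw [Measure.integral_toReal_rnDeriv hp]
        simp

end Overlap

-- Consequences for ontological models.

section Model

variable {H : Type*} [NormedAddCommGroup H] [InnerProductSpace ℂ H]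
  {Λ : Type*} [MeasurableSpace Λ]

/-- A nonnegative response of mean zero vanishes almost everywhere for `μ_ψ`, that is, for `ν` where
the density is nonzero. -/
theorem OntologicalModel.response_ae_eq_zero {m : OntologicalModel H Λ}
    (hm : m.ReproducesQuantumPredictions) {ν : Measure Λ} [IsFiniteMeasure ν] {ψ : QState H}
    (hψ : m.epistemic ψ ≪ ν) {M : QMeasurement H} {i : Fin (finrank ℂ H)}
    (h : inner ℂ (M i) ψ.1 = 0) :
    ∀ᵐ x ∂ν, (m.epistemic ψ).rnDeriv ν x ≠ 0 → m.response M i x = 0 := by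
  have := m.isProbabilityMeasure_epistemic ψ
  have h0 : ∫ l, m.response M i l ∂(m.epistemic ψ) = 0 := by simp [hm ψ M i, h]
  have hle : ∀ l, m.response M i l ≤ 1 := fun l => by
    rw [← m.sum_response M l]
    exact Finset.single_le_sum (fun j _ => m.response_nonneg M j l) (Finset.mem_univ i)
  have hint : Integrable (m.response M i) (m.epistemic ψ) :=
    Integrable.of_bound (m.measurable_response M i).aestronglyMeasurable 1
      (Filter.Eventually.of_forall fun l => by
        rw [Real.norm_of_nonneg (m.response_nonneg M i l)]; exact hle l)
  have hz := (integral_eq_zero_iff_of_nonneg (m.response_nonneg M i) hint).1 h0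
  rw [← Measure.withDensity_rnDeriv_eq (m.epistemic ψ) ν hψ] at hz
  exact (ae_withDensity_iff (Measure.measurable_rnDeriv _ _)).1 hz

theorem OntologicalModel.rnDeriv_eq_zero_of_conclusivelyExcluded {m : OntologicalModel H Λ}
    (hm : m.ReproducesQuantumPredictions) {ν : Measure Λ} [IsFiniteMeasure ν] {ψ φ χ : QState H}
    (hψ : m.epistemic ψ ≪ ν) (hφ : m.epistemic φ ≪ ν) (hχ : m.epistemic χ ≪ ν)
    (h : ConclusivelyExcluded ψ.1 φ.1 χ.1) :
    ∀ᵐ x ∂ν, (m.epistemic ψ).rnDeriv ν x = 0 ∨ (m.epistemic φ).rnDeriv ν x = 0 ∨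
      (m.epistemic χ).rnDeriv ν x = 0 := by
  obtain ⟨M, hM⟩ := h
  have hz : ∀ᵐ x ∂ν, ∀ i, (m.epistemic ψ).rnDeriv ν x ≠ 0 ∧ (m.epistemic φ).rnDeriv ν x ≠ 0 ∧
      (m.epistemic χ).rnDeriv ν x ≠ 0 → m.response M i x = 0 := by
    rw [ae_all_iff]
    intro i
    rcases hM i with h | h | h
    · filter_upwards [m.response_ae_eq_zero hm hψ h] with x hx h' using hx h'.1
    · filter_upwards [m.response_ae_eq_zero hm hφ h] with x hx h' using hx h'.2.1
    · filter_upwards [m.response_ae_eq_zero hm hχ h] with x hx h' using hx h'.2.2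
  filter_upwards [hz] with x hx
  by_contra! hne
  have := m.sum_response M x
  simp [fun i => hx i hne] at this

theorem OntologicalModel.sum_classicalOverlap_le_one {m : OntologicalModel H Λ}
    (hm : m.ReproducesQuantumPredictions) {T : Type*} [Fintype T] {ψ : QState H}
    {φ : T → QState H}
    (h : ∀ t u, t ≠ u → ConclusivelyExcluded ψ.1 (φ t).1 (φ u).1) :
    ∑ t, classicalOverlap (m.epistemic ψ) (m.epistemic (φ t)) ≤ 1 := by
  have := m.isProbabilityMeasure_epistemic
  let ν : Measure Λ := m.epistemic ψ + ∑ t, m.epistemic (φ t)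
  have hψ : m.epistemic ψ ≪ ν := Measure.absolutelyContinuous_of_le (Measure.le_add_right le_rfl)
  have hφ : ∀ t, m.epistemic (φ t) ≪ ν := fun t =>
    Measure.absolutelyContinuous_of_le (Measure.le_add_left
      (Finset.single_le_sum (f := fun t => m.epistemic (φ t)) (fun _ _ => Measure.zero_le _)
        (Finset.mem_univ t)))
  exact _root_.sum_classicalOverlap_le_one hψ hφ fun t u htu =>
    m.rnDeriv_eq_zero_of_conclusivelyExcluded hm hψ (hφ t) (hφ u) (h t u htu)

/-- The overlap bound in every dimension `d ≥ 4`, prime power or not. -/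
theorem OntologicalModel.lt_two_div_of_overlap_le {d : ℕ} (hd : 4 ≤ d) (hH : finrank ℂ H = d)
    {m : OntologicalModel H Λ} (hm : m.ReproducesQuantumPredictions) {k : ℝ}
    (hk : ∀ ψ φ : QState H,
      k * quantumOverlap ψ φ ≤ classicalOverlap (m.epistemic ψ) (m.epistemic φ)) :
    k < 2 / (d : ℝ) := by
  have hd0 : (4 : ℝ) ≤ d := by exact_mod_cast hd
  rcases le_or_gt k 0 with hk0 | hk0
  · exact hk0.trans_lt (by positivity)
  obtain ⟨T, _, ψ, φ, hT, hov, hex⟩ := exists_conclusivelyExcluded_family hd hH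
  have hT' : (d : ℝ) ^ 2 ≤ Fintype.card T := by exact_mod_cast hT
  have hQ : ∀ t, quantumOverlap ψ (φ t) = 1 - √(1 - 1 / (d : ℝ)) := fun t => by
    rw [quantumOverlap, quantumTraceDistance, hov]
  have hsum : Fintype.card T * (k * (1 - √(1 - 1 / (d : ℝ)))) ≤ 1 := by
    refine le_trans ?_ (m.sum_classicalOverlap_le_one hm hex)
    calc _ = ∑ t, k * quantumOverlap ψ (φ t) := by simp [hQ]
      _ ≤ _ := Finset.sum_le_sum fun t _ => hk ψ (φ t)
  -- The square of the right side exceeds `1 - 1/d` by `1/(4d²)`; this is what makes the final bound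
  -- strict.
  have hsqrt : √(1 - 1 / (d : ℝ)) < 1 - 1 / (2 * d) := by
    have hd1 : 1 / (2 * (d : ℝ)) < 1 := by rw [div_lt_one (by positivity)]; linarith
    rw [Real.sqrt_lt' (by linarith)]
    have : 0 < (1 / (2 * (d : ℝ))) ^ 2 := by positivity
    have h2 : 1 / (d : ℝ) = 2 * (1 / (2 * d)) := by field_simp
    rw [h2]
    nlinarith
  have hlt : (d : ℝ) ^ 2 * (k * (1 / (2 * d))) < 1 := by
    refine lt_of_lt_of_le ?_ hsum
    have h3 : k * (1 / (2 * d)) < k * (1 - √(1 - 1 / (d : ℝ))) :=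
      mul_lt_mul_of_pos_left (by linarith) hk0
    refine mul_lt_mul' hT' h3 (by positivity) (lt_of_lt_of_le (by positivity) hT')
  have h4 : (d : ℝ) ^ 2 * (k * (1 / (2 * d))) = k * d / 2 := by field_simp
  rw [h4] at hlt
  rw [lt_div_iff₀ (by positivity)]
  linarith

end Model

theorem theorem2 {H : Type*} [NormedAddCommGroup H] [InnerProductSpace ℂ H]
    {Λ : Type*} [MeasurableSpace Λ] (d : ℕ) (hd : 4 ≤ d) (hH : Module.finrank ℂ H = d)
    (m : OntologicalModel H Λ) (hm : m.ReproducesQuantumPredictions) (k : ℝ)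
    (hk : ∀ ψ φ : QState H,
      k * quantumOverlap ψ φ ≤ classicalOverlap (m.epistemic ψ) (m.epistemic φ)) :
    k < 4 / ((d : ℝ) - 1) ∧ (IsPrimePow d → k < 2 / (d : ℝ)) := by
  have h := m.lt_two_div_of_overlap_le hd hH hm hk
  refine ⟨h.trans ?_, fun _ => h⟩
  have hd0 : (4 : ℝ) ≤ d := by exact_mod_cast hd
  rw [div_lt_div_iff₀ (by linarith) (by linarith)]
  linarith
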